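/- Let $n\ge 1$, let $\varSigma$ be the set of $n\times n$ (row-)stochastic real matrices, and let $\{X_t\}_{t\ge1}$ be independent, identically distributed random matrices with values in $\varSigma$, defined on a probability space $(\Omega,\mathscr F,\mathbb P)$, with common law $\mu$ and topological support $\varSigma_\mu$ of $\mu$. Define the left products by $X^{(1)}=X_1$ and $X^{(t+1)}=X_{t+1}X^{(t)}$ for $t\ge 1$. For $t\ge1$ let $\varSigma_\mu^t$ denote the set of all products of $t$ matrices in $\varSigma_\mu$. Let $s=(s_1,\dots,s_n)\in[0,1]^n$ be a constant row vector with $\sum_i s_i=1$, and let $\mathbf 1s$ be the $n\times n$ matrix all of whose rows equal $s$. Then $X^{(t)}$ converges in probability to $\mathbf 1s$ as $t\to\infty$ if and only if $\mathbf 1s$ is the only rank-one matrix in $$\operatorname{closure}\Big(\bigcup_{t=1}^{\infty}\varSigma_\mu^t\Big),$$ that is, $\mathbf 1s$ belongs to this set and every matrix of rank one in it equals $\mathbf 1s$. -/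

import Mathlib

open MeasureTheory ProbabilityTheory Filter Topology
open scoped Pointwise

namespace RandomProducts

/-- The sigma-algebra on real square matrices generated by the entries; it is the Borel
sigma-algebra. -/
instance matrixMeasurableSpace (n : ℕ) : MeasurableSpace (Matrix (Fin n) (Fin n) ℝ) :=
  inferInstanceAs (MeasurableSpace (Fin n → Fin n → ℝ))

instance matrixBorelSpace (n : ℕ) : BorelSpace (Matrix (Fin n) (Fin n) ℝ) :=
  inferInstanceAs (BorelSpace (Fin n → Fin n → ℝ))

/-- The left products `X^(t) = X_t * ⋯ * X_1` of a sequence of random square matrices, so that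
`X^(1) = X_1` and `X^(t+1) = X_{t+1} * X^(t)`. The term `X_0` of the sequence is not used. -/
def leftProd {Ω : Type*} {n : ℕ} (X : ℕ → Ω → Matrix (Fin n) (Fin n) ℝ) :
    ℕ → Ω → Matrix (Fin n) (Fin n) ℝ
  | 0 => fun _ => 1
  | t + 1 => fun ω => X (t + 1) ω * leftProd X t ω

theorem leftProd_one {Ω : Type*} {n : ℕ} (X : ℕ → Ω → Matrix (Fin n) (Fin n) ℝ) :
    leftProd X 1 = X 1 := by
  funext ω
  simp [leftProd]

/-- The closed multiplicative semigroup generated by a set `A` of matrices: the closure of the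
union over `t ≥ 1` of the sets `A ^ t` of all products of `t` elements of `A`. -/
def closedSemigroup {n : ℕ} (A : Set (Matrix (Fin n) (Fin n) ℝ)) :
    Set (Matrix (Fin n) (Fin n) ℝ) :=
  closure (⋃ t : ℕ, ⋃ _ : 1 ≤ t, A ^ t)

section Convergence

open scoped Matrix.Norms.Elementwise

/-- Convergence in probability of a sequence of random matrices to a constant matrix, with respect
to the largest absolute value of an entry (all norms on matrices are equivalent). -/
def ConvergesInProbability {Ω : Type*} [MeasurableSpace Ω] (P : Measure Ω) {n : ℕ}
    (Y : ℕ → Ω → Matrix (Fin n) (Fin n) ℝ) (L : Matrix (Fin n) (Fin n) ℝ) : Prop :=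
  ∀ ε : ℝ, 0 < ε → Tendsto (fun t => P {ω | ε ≤ ‖Y t ω - L‖}) atTop (𝓝 0)

end Convergence

end RandomProducts

/-!
Everything happens in a topological monoid `M`, for the convolution powers `μ^{*t}` of a probability
measure `μ` carried by a compact submonoid `K` with `x * L = L` for all `x ∈ K`.

If `μ^{*t} → δ_L`, then `L` lies in every closed set that carries all the `μ^{*t}` with `t ≥ 1`,
hence in the closed semigroup `S` generated by the support of `μ`, and the limit of
`μ^{*(t+1)} = μ^{*t} * μ` gives `L * x = L` for all `x` in the support.

Conversely, if `L ∈ S` and `L * x = L` on the support, then `L` is a zero element of the closed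
submonoid `N = {x ∈ K | L * x = L}`, which carries `μ`. By compactness of `N` every neighbourhood of
`L` contains an open `I ∋ L` with `N * I * N ⊆ I`. A product of elements of `N` avoids `I` only if
all its factors do, so `t ↦ μ^{*t}(Iᶜ)` is submultiplicative; it is below `1` for some `t` because
`L ∈ S`, and therefore it tends to `0`.

For stochastic matrices and `L = 𝟏s`, these two conditions on `L` say that `L` is the only matrix of
rank one in `S`, because a stochastic matrix has rank one exactly when its rows are equal.
-/

namespace RandomProducts

open Measure

section ConvolutionPowers

variable {M : Type*} [Monoid M] [MeasurableSpace M]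

/-- The `t`-fold multiplicative convolution power of a measure `μ` on a monoid, which for a
probability measure is the law of a product of `t` independent factors of law `μ`. -/
noncomputable def mconvPow (μ : Measure M) : ℕ → Measure M
  | 0 => dirac 1
  | t + 1 => μ ∗ₘ mconvPow μ t

variable [MeasurableMul₂ M]

instance isProbabilityMeasure_mconvPow (μ : Measure M) [IsProbabilityMeasure μ] (t : ℕ) :
    IsProbabilityMeasure (mconvPow μ t) := by
  induction t with
  | zero => exact inferInstanceAs (IsProbabilityMeasure (dirac 1))
  | succ t _ => exact inferInstanceAs (IsProbabilityMeasure (μ ∗ₘ mconvPow μ t))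

theorem mconvPow_one (μ : Measure M) [SFinite μ] : mconvPow μ 1 = μ :=
  mconv_dirac_one μ

theorem mconvPow_add (μ : Measure M) [IsProbabilityMeasure μ] (m t : ℕ) :
    mconvPow μ (m + t) = mconvPow μ m ∗ₘ mconvPow μ t := by
  induction m with
  | zero => rw [Nat.zero_add, mconvPow, dirac_one_mconv]
  | succ m ih => rw [Nat.succ_add, mconvPow, ih, mconvPow, mconv_assoc]

theorem mconvPow_succ' (μ : Measure M) [IsProbabilityMeasure μ] (t : ℕ) :
    mconvPow μ (t + 1) = mconvPow μ t ∗ₘ μ := by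
  rw [mconvPow_add, mconvPow_one]

theorem measure_mul_measure_le_mconv {μ ν : Measure M} [SFinite ν] {U V W : Set M}
    (hW : MeasurableSet W) (h : ∀ x ∈ U, ∀ y ∈ V, x * y ∈ W) : μ U * ν V ≤ (μ ∗ₘ ν) W := by
  rw [mconv, map_apply measurable_mul hW, ← prod_prod]
  exact measure_mono fun p hp => h _ hp.1 _ hp.2

theorem mconv_le_measure_mul_measure {μ ν : Measure M} [SFinite ν] {A B U V W : Set M}
    (hμ : ∀ᵐ x ∂μ, x ∈ A) (hν : ∀ᵐ y ∂ν, y ∈ B) (hW : MeasurableSet W)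
    (h : ∀ x ∈ A, ∀ y ∈ B, x * y ∈ W → x ∈ U ∧ y ∈ V) : (μ ∗ₘ ν) W ≤ μ U * ν V := by
  rw [mconv, map_apply measurable_mul hW, ← prod_prod]
  refine measure_mono_ae ?_
  filter_upwards [quasiMeasurePreserving_fst.ae hμ, quasiMeasurePreserving_snd.ae hν]
    with p hp₁ hp₂ hp using h _ hp₁ _ hp₂ hp

theorem ae_mem_mconv {μ ν : Measure M} {S : Subsemigroup M}
    (hS : MeasurableSet (S : Set M)) (hμ : ∀ᵐ x ∂μ, x ∈ S) (hν : ∀ᵐ y ∂ν, y ∈ S) :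
    ∀ᵐ z ∂(μ ∗ₘ ν), z ∈ S := by
  refine (ae_map_iff (p := (· ∈ S)) measurable_mul.aemeasurable hS).2 ?_
  filter_upwards [quasiMeasurePreserving_fst.ae hμ, quasiMeasurePreserving_snd.ae hν]
    with p hp₁ hp₂ using S.mul_mem hp₁ hp₂

theorem ae_mem_mconvPow_succ {μ : Measure M} [IsProbabilityMeasure μ] {S : Subsemigroup M}
    (hS : MeasurableSet (S : Set M)) (hμ : ∀ᵐ x ∂μ, x ∈ S) (t : ℕ) :
    ∀ᵐ x ∂mconvPow μ (t + 1), x ∈ S := by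
  induction t with
  | zero => rwa [zero_add, mconvPow_one]
  | succ t ih => exact ae_mem_mconv hS hμ ih

theorem ae_mem_mconvPow {μ : Measure M} [IsProbabilityMeasure μ] {N : Submonoid M}
    (hN : MeasurableSet (N : Set M)) (hμ : ∀ᵐ x ∂μ, x ∈ N) :
    ∀ t, ∀ᵐ x ∂mconvPow μ t, x ∈ N
  | 0 => (ae_dirac_iff hN).2 N.one_mem
  | t + 1 => ae_mem_mconvPow_succ (S := N.toSubsemigroup) hN hμ t

variable [TopologicalSpace M] [ContinuousMul M] [OpensMeasurableSpace M]

theorem mul_mem_support_mconv {μ ν : Measure M} [SFinite ν] {x y : M} (hx : x ∈ μ.support)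
    (hy : y ∈ ν.support) : x * y ∈ (μ ∗ₘ ν).support := by
  rw [(nhds_basis_opens _).mem_measureSupport]
  rintro W ⟨hxy, hW⟩
  have hmul : (fun p : M × M => p.1 * p.2) ⁻¹' W ∈ 𝓝 (x, y) :=
    (hW.preimage continuous_mul).mem_nhds hxy
  obtain ⟨U, hU, V, hV, hUV⟩ := mem_nhds_prod_iff.1 hmul
  calc 0 < μ U * ν V := ENNReal.mul_pos ((mem_support_iff_forall x).1 hx U hU).ne'
        ((mem_support_iff_forall y).1 hy V hV).ne'
    _ ≤ (μ ∗ₘ ν) W := measure_mul_measure_le_mconv hW.measurableSet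
        fun a ha b hb => hUV (Set.mk_mem_prod ha hb)

theorem exists_mem_support_mconvPow {μ : Measure M} [IsProbabilityMeasure μ] {x : M}
    (hx : x ∈ Subsemigroup.closure μ.support) : ∃ t, x ∈ (mconvPow μ t).support := by
  induction hx using Subsemigroup.closure_induction with
  | mem x hx => exact ⟨1, by rwa [mconvPow_one]⟩
  | mul x y _ _ ihx ihy =>
    obtain ⟨m, hm⟩ := ihx
    obtain ⟨t, ht⟩ := ihy
    exact ⟨m + t, mconvPow_add μ m t ▸ mul_mem_support_mconv hm ht⟩

end ConvolutionPowers

section Concentration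

variable {M : Type*} [TopologicalSpace M] [MeasurableSpace M] [OpensMeasurableSpace M]

/-- The mass of `ν t` outside each neighbourhood of `L` vanishes as `t → ∞`. For probability
measures this is weak convergence to the Dirac measure at `L`, stated without a metric. -/
def ConcentratesAt (ν : ℕ → Measure M) (L : M) : Prop :=
  ∀ U ∈ 𝓝 L, Tendsto (fun t => ν t Uᶜ) atTop (𝓝 0)

namespace ConcentratesAt

variable {ν : ℕ → Measure M} [∀ t, IsProbabilityMeasure (ν t)] {L : M}

theorem tendsto_measure_one (hν : ConcentratesAt ν L) {U : Set M} (hU : IsOpen U) (hL : L ∈ U) :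
    Tendsto (fun t => ν t U) atTop (𝓝 1) := by
  have hcompl := ENNReal.Tendsto.sub tendsto_const_nhds (hν U (hU.mem_nhds hL))
    (Or.inl ENNReal.one_ne_top)
  simpa only [← prob_compl_eq_one_sub hU.measurableSet.compl, compl_compl, tsub_zero] using hcompl

theorem mem_of_isClosed (hν : ConcentratesAt ν L) {C : Set M} (hC : IsClosed C)
    (h : ∀ᶠ t in atTop, ∀ᵐ x ∂ν t, x ∈ C) : L ∈ C := by
  by_contra hL
  have hone := hν.tendsto_measure_one hC.isOpen_compl hL
  have hzero : Tendsto (fun t => ν t Cᶜ) atTop (𝓝 0) :=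
    tendsto_const_nhds.congr' (h.mono fun t ht => (mem_ae_iff.1 ht).symm)
  exact one_ne_zero (tendsto_nhds_unique hone hzero)

theorem mul_eq [Monoid M] [ContinuousMul M] [MeasurableMul₂ M] [T2Space M]
    (hν : ConcentratesAt ν L) {μ : Measure M} [SFinite μ] {L' : M}
    (hνμ : ConcentratesAt (fun t => ν t ∗ₘ μ) L') {x : M} (hx : x ∈ μ.support) : L * x = L' := by
  by_contra hne
  obtain ⟨A, B, hA, hB, hLx, hL', hAB⟩ := t2_separation hne
  have hmul : (fun p : M × M => p.1 * p.2) ⁻¹' A ∈ 𝓝 (L, x) :=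
    (hA.preimage continuous_mul).mem_nhds hLx
  obtain ⟨U, V, hU, hLU, hV, hxV, hUV⟩ := mem_nhds_prod_iff'.1 hmul
  have hle : ∀ t, ν t U * μ V ≤ (ν t ∗ₘ μ) Bᶜ := fun t =>
    (measure_mul_measure_le_mconv hA.measurableSet
      fun a ha b hb => hUV (Set.mk_mem_prod ha hb)).trans (measure_mono hAB.subset_compl_right)
  have hlim : Tendsto (fun t => ν t U * μ V) atTop (𝓝 (1 * μ V)) :=
    ENNReal.Tendsto.mul_const (hν.tendsto_measure_one hU hLU) (Or.inl one_ne_zero)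
  have hV0 : 1 * μ V ≤ 0 := le_of_tendsto_of_tendsto' hlim (hνμ B (hB.mem_nhds hL')) hle
  rw [one_mul] at hV0
  exact hV0.not_gt ((mem_support_iff_forall x).1 hx V (hV.mem_nhds hxV))

end ConcentratesAt

end Concentration

theorem tendsto_zero_of_submultiplicative {f : ℕ → ENNReal} (hf : ∀ m t, f (m + t) ≤ f m * f t)
    (hf_one : ∀ t, f t ≤ 1) {m : ℕ} (hm : f m < 1) : Tendsto f atTop (𝓝 0) := by
  have hanti : Antitone f := antitone_nat_of_succ_le fun t =>
    (hf t 1).trans (mul_le_of_le_one_right' (hf_one 1))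
  have hpow : ∀ k, f (k * m) ≤ f m ^ k := fun k => by
    induction k with
    | zero => simpa using hf_one 0
    | succ k ih =>
      rw [Nat.succ_mul, pow_succ]
      exact (hf _ _).trans (mul_le_mul_left ih _)
  refine ENNReal.tendsto_nhds_zero.2 fun ε hε => ?_
  obtain ⟨k, hk⟩ := (ENNReal.tendsto_nhds_zero.1
    (ENNReal.tendsto_pow_atTop_nhds_zero_of_lt_one hm) ε hε).exists
  filter_upwards [eventually_ge_atTop (k * m)] with t ht
  exact (hanti ht).trans ((hpow k).trans hk)

section BiinvariantCore

variable {M : Type*} [Monoid M] {N : Submonoid M} {U : Set M}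

/-- The largest subset of `U` that is stable under multiplication by `N` on both sides. It refines a
neighbourhood `U` to one that no product of elements of `N` leaves once a factor lies in it. -/
def biinvariantCore (N : Submonoid M) (U : Set M) : Set M :=
  {x | ∀ a ∈ N, ∀ b ∈ N, a * x * b ∈ U}

theorem biinvariantCore_subset : biinvariantCore N U ⊆ U := fun x hx => by
  simpa using hx 1 N.one_mem 1 N.one_mem

theorem mul_mem_biinvariantCore_right {x y : M} (hx : x ∈ biinvariantCore N U) (hy : y ∈ N) :
    x * y ∈ biinvariantCore N U := fun a ha b hb => by
  simpa only [mul_assoc] using hx a ha (y * b) (N.mul_mem hy hb)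

theorem mul_mem_biinvariantCore_left {x y : M} (hx : x ∈ N) (hy : y ∈ biinvariantCore N U) :
    x * y ∈ biinvariantCore N U := fun a ha b hb => by
  simpa only [mul_assoc] using hy (a * x) (N.mul_mem ha hx) b hb

theorem isOpen_biinvariantCore [TopologicalSpace M] [ContinuousMul M]
    (hN : IsCompact (N : Set M)) (hU : IsOpen U) : IsOpen (biinvariantCore N U) := by
  have hcont : Continuous fun q : M × M × M => q.2.1 * q.1 * q.2.2 := by fun_prop
  refine isOpen_iff_eventually.2 fun x hx => ?_
  have hprod : ∀ᶠ y in 𝓝 x, ∀ p ∈ (N : Set M) ×ˢ (N : Set M), p.1 * y * p.2 ∈ U :=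
    (hN.prod hN).eventually_forall_of_forall_eventually fun p hp =>
      (hU.preimage hcont).mem_nhds (hx p.1 hp.1 p.2 hp.2)
  exact hprod.mono fun y hy a ha b hb => hy (a, b) ⟨ha, hb⟩

end BiinvariantCore

section CompactMonoid

variable {M : Type*} [Monoid M]

/-- The submonoid of all `x` with `L * x = L`, that is, the stabilizer of `L` under right
multiplication. Mathlib's stabilizer lives in `Mᵐᵒᵖ` because right multiplication is a left action
of the opposite monoid. -/
def rightStabilizer (L : M) : Submonoid M :=
  (MulAction.stabilizerSubmonoid Mᵐᵒᵖ L).unop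

variable [TopologicalSpace M] [ContinuousMul M]

theorem isClosed_rightStabilizer [T2Space M] (L : M) : IsClosed (rightStabilizer L : Set M) :=
  isClosed_eq (continuous_const.mul continuous_id) continuous_const

variable [SecondCountableTopology M] [MeasurableSpace M] [BorelSpace M]
  {μ : Measure M} [IsProbabilityMeasure μ] {L : M}

theorem ConcentratesAt.mem_topologicalClosure (h : ConcentratesAt (mconvPow μ) L) :
    L ∈ (Subsemigroup.closure μ.support).topologicalClosure := by
  set S := (Subsemigroup.closure μ.support).topologicalClosure
  have hS : IsClosed (S : Set M) := Subsemigroup.isClosed_topologicalClosure _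
  have hμ : ∀ᵐ x ∂μ, x ∈ S := mem_of_superset support_mem_ae
    (Subsemigroup.subset_closure.trans (Subsemigroup.le_topologicalClosure _))
  refine h.mem_of_isClosed hS ?_
  filter_upwards [eventually_ge_atTop 1] with t ht
  obtain ⟨t, rfl⟩ := Nat.exists_eq_add_of_le' ht
  exact ae_mem_mconvPow_succ hS.measurableSet hμ t

theorem exists_mconvPow_compl_lt_one
    (hL : L ∈ (Subsemigroup.closure μ.support).topologicalClosure) {U : Set M} (hU : IsOpen U)
    (hLU : L ∈ U) : ∃ t, mconvPow μ t Uᶜ < 1 := by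
  obtain ⟨x, hxU, hx⟩ := mem_closure_iff.1 hL U hU hLU
  obtain ⟨t, ht⟩ := exists_mem_support_mconvPow hx
  have hpos : 0 < mconvPow μ t U := (mem_support_iff_forall x).1 ht U (hU.mem_nhds hxU)
  refine ⟨t, ?_⟩
  rw [prob_compl_eq_one_sub hU.measurableSet]
  exact ENNReal.sub_lt_self ENNReal.one_ne_top one_ne_zero hpos.ne'

variable [T2Space M]

theorem mconvPow_compl_biinvariantCore_add_le {N : Submonoid M} (hN : IsCompact (N : Set M))
    (hμ : ∀ᵐ x ∂μ, x ∈ N) {U : Set M} (hU : IsOpen U) (m t : ℕ) :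
    mconvPow μ (m + t) (biinvariantCore N U)ᶜ ≤
      mconvPow μ m (biinvariantCore N U)ᶜ * mconvPow μ t (biinvariantCore N U)ᶜ := by
  have hae := ae_mem_mconvPow hN.isClosed.measurableSet hμ
  rw [mconvPow_add]
  exact mconv_le_measure_mul_measure (hae m) (hae t)
    (isOpen_biinvariantCore hN hU).measurableSet.compl fun x hx y hy hxy =>
      ⟨fun h => hxy (mul_mem_biinvariantCore_right h hy),
        fun h => hxy (mul_mem_biinvariantCore_left hx h)⟩

theorem concentratesAt_mconvPow_of_mem_topologicalClosure {N : Submonoid M}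
    (hN : IsCompact (N : Set M)) (hμ : ∀ᵐ x ∂μ, x ∈ N) (hleft : ∀ x ∈ N, x * L = L)
    (hright : ∀ x ∈ N, L * x = L)
    (hL : L ∈ (Subsemigroup.closure μ.support).topologicalClosure) :
    ConcentratesAt (mconvPow μ) L := by
  intro W hW
  obtain ⟨U, hUW, hU, hLU⟩ := mem_nhds_iff.1 hW
  have hLI : L ∈ biinvariantCore N U := fun a ha b hb => by rwa [hleft a ha, hright b hb]
  obtain ⟨m, hm⟩ := exists_mconvPow_compl_lt_one hL (isOpen_biinvariantCore hN hU) hLI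
  have hcore : Tendsto (fun t => mconvPow μ t (biinvariantCore N U)ᶜ) atTop (𝓝 0) :=
    tendsto_zero_of_submultiplicative (mconvPow_compl_biinvariantCore_add_le hN hμ hU)
      (fun _ => prob_le_one) hm
  exact tendsto_of_tendsto_of_tendsto_of_le_of_le tendsto_const_nhds hcore (fun _ => zero_le)
    fun t => measure_mono (Set.compl_subset_compl.2 (biinvariantCore_subset.trans hUW))

theorem concentratesAt_mconvPow_iff {K : Submonoid M} (hK : IsCompact (K : Set M))
    (hμ : μ.support ⊆ K) (hL : ∀ x ∈ K, x * L = L) :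
    ConcentratesAt (mconvPow μ) L ↔
      L ∈ (Subsemigroup.closure μ.support).topologicalClosure ∧ ∀ x ∈ μ.support, L * x = L := by
  constructor
  · intro h
    have hsucc : ConcentratesAt (fun t => mconvPow μ t ∗ₘ μ) L := fun U hU => by
      simpa only [← mconvPow_succ'] using (tendsto_add_atTop_iff_nat 1).2 (h U hU)
    exact ⟨h.mem_topologicalClosure, fun x hx => h.mul_eq hsucc hx⟩
  · rintro ⟨hmem, hfix⟩
    have hN : IsCompact ((K ⊓ rightStabilizer L : Submonoid M) : Set M) :=
      hK.inter_right (isClosed_rightStabilizer L)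
    have hμN : ∀ᵐ x ∂μ, x ∈ K ⊓ rightStabilizer L :=
      mem_of_superset support_mem_ae fun x hx => ⟨hμ hx, hfix x hx⟩
    exact concentratesAt_mconvPow_of_mem_topologicalClosure hN hμN (fun x hx => hL x hx.1)
      (fun x hx => hx.2) hmem

end CompactMonoid

section StochasticMatrices

open Matrix

variable {m ι 𝕜 : Type*} [Fintype ι]

theorem rank_le_one_iff_exists_eq_vecMulVec [Field 𝕜] {σ : Matrix m ι 𝕜} :
    σ.rank ≤ 1 ↔ ∃ u v, σ = vecMulVec u v := by
  classical
  refine ⟨fun h => ?_, ?_⟩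
  · obtain ⟨u, hu⟩ := finrank_le_one_iff.1 h
    choose v hv using fun j => hu ⟨σ *ᵥ Pi.single j 1, LinearMap.mem_range_self σ.mulVecLin _⟩
    refine ⟨u, v, ?_⟩
    ext i j
    have hcol := congrFun (congrArg Subtype.val (hv j)) i
    simpa [vecMulVec_apply, mul_comm] using hcol.symm
  · rintro ⟨u, v, rfl⟩
    exact rank_vecMulVec_le u v

theorem rank_eq_one_iff_of_mulVec_one [Field 𝕜] [Nonempty m] {σ : Matrix m ι 𝕜}
    (hσ : σ *ᵥ 1 = 1) : σ.rank = 1 ↔ ∃ r, σ = vecMulVec 1 r := by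
  have hrank : σ.rank ≠ 0 := by
    intro h
    have hbot : LinearMap.range σ.mulVecLin = ⊥ := Submodule.finrank_eq_zero.1 h
    have hzero : σ *ᵥ 1 = 0 := by simpa using LinearMap.congr_fun (LinearMap.range_eq_bot.1 hbot) 1
    exact one_ne_zero (hσ.symm.trans hzero)
  refine ⟨fun h => ?_, ?_⟩
  · obtain ⟨u, v, rfl⟩ := rank_le_one_iff_exists_eq_vecMulVec.1 h.le
    refine ⟨(v ⬝ᵥ 1)⁻¹ • v, ?_⟩
    ext i j
    have hi : u i * (v ⬝ᵥ 1) = 1 := by simpa [vecMulVec_mulVec] using congrFun hσ i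
    simp [vecMulVec_apply, eq_inv_of_mul_eq_one_left hi]
  · rintro ⟨r, rfl⟩
    exact le_antisymm (rank_vecMulVec_le 1 r) (Nat.one_le_iff_ne_zero.2 hrank)

variable [DecidableEq ι]

theorem mul_vecMulVec_one_of_mem_rowStochastic [CommRing 𝕜] [PartialOrder 𝕜] [IsOrderedRing 𝕜]
    {σ : Matrix ι ι 𝕜} (hσ : σ ∈ rowStochastic 𝕜 ι) (r : m → 𝕜) :
    σ * vecMulVec (1 : ι → 𝕜) r = vecMulVec 1 r := by
  rw [mul_vecMulVec, hσ.2]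

theorem coe_rowStochastic_eq_pi :
    (rowStochastic ℝ ι : Set (Matrix ι ι ℝ)) = Set.univ.pi fun _ : ι => stdSimplex ℝ ι := by
  ext σ
  rw [SetLike.mem_coe, mem_rowStochastic_iff_sum, ← forall_and]
  exact Set.mem_univ_pi.symm

theorem isCompact_rowStochastic : IsCompact (rowStochastic ℝ ι : Set (Matrix ι ι ℝ)) := by
  rw [coe_rowStochastic_eq_pi]
  exact isCompact_univ_pi fun _ => isCompact_stdSimplex ℝ ι

end StochasticMatrices

section ClosedSemigroup

open Matrix

theorem coe_subsemigroupClosure_eq_iUnion_pow {M : Type*} [Monoid M] (A : Set M) :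
    (Subsemigroup.closure A : Set M) = ⋃ t : ℕ, ⋃ _ : 1 ≤ t, A ^ t := by
  refine Set.Subset.antisymm (fun x hx => ?_) (Set.iUnion₂_subset fun t ht => ?_)
  · induction hx using Subsemigroup.closure_induction with
    | mem x hx => exact Set.mem_iUnion₂.2 ⟨1, le_rfl, by rwa [pow_one]⟩
    | mul x y _ _ ihx ihy =>
      obtain ⟨m, hm, hx⟩ := Set.mem_iUnion₂.1 ihx
      obtain ⟨t, -, hy⟩ := Set.mem_iUnion₂.1 ihy
      exact Set.mem_iUnion₂.2 ⟨m + t, by lia, pow_add A m t ▸ Set.mul_mem_mul hx hy⟩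
  · induction t, ht using Nat.le_induction with
    | base => simp
    | succ t _ ih =>
      rw [pow_succ]
      exact Set.mul_subset_iff.2 fun x hx y hy =>
        Subsemigroup.mul_mem _ (ih hx) (Subsemigroup.subset_closure hy)

variable {n : ℕ} {A : Set (Matrix (Fin n) (Fin n) ℝ)}

theorem closedSemigroup_eq_topologicalClosure (A : Set (Matrix (Fin n) (Fin n) ℝ)) :
    closedSemigroup A = (Subsemigroup.closure A).topologicalClosure := by
  rw [Subsemigroup.coe_topologicalClosure, coe_subsemigroupClosure_eq_iUnion_pow, closedSemigroup]

theorem closedSemigroup_subset_of_isClosed {N : Submonoid (Matrix (Fin n) (Fin n) ℝ)}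
    (hN : IsClosed (N : Set (Matrix (Fin n) (Fin n) ℝ))) (hA : A ⊆ N) : closedSemigroup A ⊆ N := by
  rw [closedSemigroup_eq_topologicalClosure]
  exact Subsemigroup.topologicalClosure_minimal _
    (Subsemigroup.closure_le (S := N.toSubsemigroup).2 hA) hN

theorem mul_mem_closedSemigroup {σ τ : Matrix (Fin n) (Fin n) ℝ} (hσ : σ ∈ closedSemigroup A)
    (hτ : τ ∈ A) : σ * τ ∈ closedSemigroup A := by
  rw [closedSemigroup_eq_topologicalClosure] at hσ ⊢
  exact mul_mem hσ (Subsemigroup.le_topologicalClosure _ (Subsemigroup.subset_closure hτ))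

theorem setOf_rank_eq_one_closedSemigroup_eq_singleton_iff [NeZero n]
    (hA : A ⊆ rowStochastic ℝ (Fin n)) {s : Fin n → ℝ} :
    {σ ∈ closedSemigroup A | σ.rank = 1} = {vecMulVec 1 s} ↔
      vecMulVec 1 s ∈ closedSemigroup A ∧
        ∀ σ ∈ A, vecMulVec (1 : Fin n → ℝ) s * σ = vecMulVec 1 s := by
  have hS : closedSemigroup A ⊆ rowStochastic ℝ (Fin n) :=
    closedSemigroup_subset_of_isClosed isCompact_rowStochastic.isClosed hA
  constructor
  · intro h
    have hs : vecMulVec 1 s ∈ closedSemigroup A := (h.symm.subset rfl).1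
    refine ⟨hs, fun σ hσ => h.subset ⟨mul_mem_closedSemigroup hs hσ, ?_⟩⟩
    have hsσ := hS (mul_mem_closedSemigroup hs hσ)
    exact (rank_eq_one_iff_of_mulVec_one hsσ.2).2 ⟨s ᵥ* σ, vecMulVec_mul 1 s σ⟩
  · rintro ⟨hs, hfix⟩
    have hstab := closedSemigroup_subset_of_isClosed (isClosed_rightStabilizer _) hfix
    refine Set.Subset.antisymm ?_
      (Set.singleton_subset_iff.2 ⟨hs, (rank_eq_one_iff_of_mulVec_one (hS hs).2).2 ⟨s, rfl⟩⟩)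
    rintro σ ⟨hσ, hrank⟩
    obtain ⟨r, rfl⟩ := (rank_eq_one_iff_of_mulVec_one (hS hσ).2).1 hrank
    calc vecMulVec 1 r = vecMulVec (1 : Fin n → ℝ) s * vecMulVec 1 r :=
          (mul_vecMulVec_one_of_mem_rowStochastic (hS hs) r).symm
      _ = vecMulVec 1 s := hstab hσ

end ClosedSemigroup

section LeftProducts

instance secondCountableTopology_matrix {m k R : Type*} [Countable m] [Countable k]
    [TopologicalSpace R] [SecondCountableTopology R] :
    SecondCountableTopology (Matrix m k R) :=
  inferInstanceAs (SecondCountableTopology (m → k → R))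

variable {Ω : Type*} {n : ℕ} {X : ℕ → Ω → Matrix (Fin n) (Fin n) ℝ}

theorem measurable_leftProd [MeasurableSpace Ω] {t : ℕ}
    (hX : ∀ i, 1 ≤ i → i ≤ t → Measurable (X i)) : Measurable (leftProd X t) := by
  induction t with
  | zero => exact measurable_const
  | succ t ih =>
    exact (hX (t + 1) (by lia) le_rfl).mul (ih fun i hi hit => hX i hi (by lia))

variable [MeasurableSpace Ω] {P : Measure Ω}

theorem indepFun_leftProd (hX : ∀ t, 1 ≤ t → Measurable (X t))
    (hindep : iIndepFun (fun t : {t : ℕ // 1 ≤ t} => X t) P) (t : ℕ) :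
    IndepFun (X (t + 1)) (leftProd X t) P := by
  let m (i : {t : ℕ // 1 ≤ t}) : MeasurableSpace Ω := MeasurableSpace.comap (X i) inferInstance
  let past : Set {t : ℕ // 1 ≤ t} := {i | i.1 ≤ t}
  have hdisj : Disjoint {⟨t + 1, by lia⟩} past :=
    Set.disjoint_singleton_left.2 (Nat.not_succ_le_self t)
  have hle (i : {t : ℕ // 1 ≤ t}) {T : Set {t : ℕ // 1 ≤ t}} (hi : i ∈ T) :
      m i ≤ ⨆ j ∈ T, m j := le_iSup₂_of_le i hi le_rfl
  have hindepσ := indep_iSup_of_disjoint (fun i : {t : ℕ // 1 ≤ t} => (hX i i.2).comap_le)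
    hindep.iIndep hdisj
  refine indep_of_indep_of_le_left (indep_of_indep_of_le_right hindepσ ?_)
    (hle ⟨t + 1, by lia⟩ rfl)
  -- `leftProd X t` is measurable already for the σ-algebra of the past `X 1, …, X t`.
  refine Measurable.comap_le (@measurable_leftProd Ω n X (⨆ j ∈ past, m j) t ?_)
  exact fun i hi hit => Measurable.of_comap_le (hle ⟨i, hi⟩ hit)

theorem map_leftProd (hX : ∀ t, 1 ≤ t → Measurable (X t))
    (hindep : iIndepFun (fun t : {t : ℕ // 1 ≤ t} => X t) P)
    {μ : Measure (Matrix (Fin n) (Fin n) ℝ)} (hlaw : ∀ t, 1 ≤ t → P.map (X t) = μ) (t : ℕ) :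
    P.map (leftProd X t) = mconvPow μ t := by
  have := hindep.isProbabilityMeasure
  induction t with
  | zero => simp [leftProd, mconvPow]
  | succ t ih =>
    rw [mconvPow, ← ih, ← hlaw (t + 1) (by lia)]
    exact (indepFun_leftProd hX hindep t).map_mul_eq_map_mconv_map (hX (t + 1) (by lia))
      (measurable_leftProd fun i hi _ => hX i hi)

open scoped Matrix.Norms.Elementwise

theorem nhds_basis_norm_sub_lt (L : Matrix (Fin n) (Fin n) ℝ) :
    (𝓝 L).HasBasis (fun ε : ℝ => 0 < ε) fun ε => {σ | ‖σ - L‖ < ε} :=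
  (Metric.nhds_basis_ball (α := Fin n → Fin n → ℝ)).congr (fun _ => Iff.rfl)
    fun _ _ => Set.ext fun _ => mem_ball_iff_norm

theorem measurable_norm_sub (L : Matrix (Fin n) (Fin n) ℝ) :
    Measurable fun σ : Matrix (Fin n) (Fin n) ℝ => ‖σ - L‖ :=
  (measurable_norm (α := Fin n → Fin n → ℝ)).comp (measurable_id.sub_const L)

theorem convergesInProbability_iff_concentratesAt {Y : ℕ → Ω → Matrix (Fin n) (Fin n) ℝ}
    (hY : ∀ t, Measurable (Y t)) {L : Matrix (Fin n) (Fin n) ℝ} :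
    ConvergesInProbability P Y L ↔ ConcentratesAt (fun t => P.map (Y t)) L := by
  have hball (ε : ℝ) (t : ℕ) : P.map (Y t) {σ | ‖σ - L‖ < ε}ᶜ = P {ω | ε ≤ ‖Y t ω - L‖} := by
    rw [map_apply (hY t) (measurableSet_lt (measurable_norm_sub L) measurable_const).compl]
    simp only [Set.preimage_ofPred_eq, Set.compl_ofPred, not_lt]
  refine Iff.symm (((nhds_basis_norm_sub_lt L).forall_iff fun U V hUV hU => ?_).trans ?_)
  · exact tendsto_of_tendsto_of_tendsto_of_le_of_le tendsto_const_nhds hU (fun _ => zero_le)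
      fun t => measure_mono (Set.compl_subset_compl.2 hUV)
  · simp only [hball, ConvergesInProbability]

end LeftProducts

end RandomProducts

theorem proposition1_general {Ω : Type*} [MeasurableSpace Ω] (P : Measure Ω) (n : ℕ) [NeZero n]
    (X : ℕ → Ω → Matrix (Fin n) (Fin n) ℝ) (hX_meas : ∀ t, 1 ≤ t → Measurable (X t))
    (hX_stoch : ∀ᵐ ω ∂P, X 1 ω ∈ Matrix.rowStochastic ℝ (Fin n))
    (hX_indep : iIndepFun (fun t : {t : ℕ // 1 ≤ t} => X t) P)
    (μ : Measure (Matrix (Fin n) (Fin n) ℝ)) (hX_law : ∀ t, 1 ≤ t → P.map (X t) = μ)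
    (s : Fin n → ℝ) :
    RandomProducts.ConvergesInProbability P (RandomProducts.leftProd X) (Matrix.vecMulVec 1 s) ↔
      {σ ∈ RandomProducts.closedSemigroup μ.support | σ.rank = 1} = {Matrix.vecMulVec 1 s} := by
  have := hX_indep.isProbabilityMeasure
  have : IsProbabilityMeasure μ :=
    hX_law 1 le_rfl ▸ Measure.isProbabilityMeasure_map (hX_meas 1 le_rfl).aemeasurable
  have hcompact := RandomProducts.isCompact_rowStochastic (ι := Fin n)
  have hμ : ∀ᵐ σ ∂μ, σ ∈ Matrix.rowStochastic ℝ (Fin n) := hX_law 1 le_rfl ▸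
    (ae_map_iff (hX_meas 1 le_rfl).aemeasurable hcompact.isClosed.measurableSet).2 hX_stoch
  have hsupp := Measure.support_subset_of_isClosed hcompact.isClosed hμ
  rw [RandomProducts.convergesInProbability_iff_concentratesAt
      fun t => RandomProducts.measurable_leftProd fun i hi _ => hX_meas i hi,
    RandomProducts.setOf_rank_eq_one_closedSemigroup_eq_singleton_iff hsupp,
    RandomProducts.closedSemigroup_eq_topologicalClosure]
  simp only [RandomProducts.map_leftProd hX_meas hX_indep hX_law]
  exact RandomProducts.concentratesAt_mconvPow_iff hcompact hsupp
    fun σ hσ => RandomProducts.mul_vecMulVec_one_of_mem_rowStochastic hσ s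

theorem proposition1 {Ω : Type*} [MeasurableSpace Ω] (P : Measure Ω) [IsProbabilityMeasure P]
    (n : ℕ) (X : ℕ → Ω → Matrix (Fin n) (Fin n) ℝ)
    (hX_meas : ∀ t, 1 ≤ t → Measurable (X t))
    (hX_stoch : ∀ t, 1 ≤ t → ∀ ω, X t ω ∈ Matrix.rowStochastic ℝ (Fin n))
    (hX_indep : iIndepFun (fun t : {t : ℕ // 1 ≤ t} => X t) P)
    (μ : Measure (Matrix (Fin n) (Fin n) ℝ))
    (hX_law : ∀ t, 1 ≤ t → P.map (X t) = μ)
    (s : Fin n → ℝ) (hs : s ∈ stdSimplex ℝ (Fin n)) :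
    RandomProducts.ConvergesInProbability P (RandomProducts.leftProd X) (Matrix.vecMulVec 1 s) ↔
      {σ ∈ RandomProducts.closedSemigroup μ.support | σ.rank = 1} = {Matrix.vecMulVec 1 s} := by
  have : NeZero n := ⟨by rintro rfl; simpa using hs.2⟩
  exact proposition1_general P n X hX_meas (ae_of_all _ (hX_stoch 1 le_rfl)) hX_indep μ hX_law s
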